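/- Let $G$ be a finite simple undirected graph with vertex set $V(G)$. Let $\chi(G)$ be its chromatic number, let $\omega(G)$ be the largest number of pairwise adjacent vertices of $G$, and put $f(G)=\chi(G)-\omega(G)$. If $f(G)\le 4$, then $|V(G)|\ge\chi(G)+2f(G)$. -/

import Mathlib

/-- The difference `f(G) = χ(G) - ω(G)` of the chromatic number and the clique number of a
finite graph `G`, as an integer. The chromatic number of a finite graph is finite, so `toNat`
loses nothing. -/
noncomputable def chromaticGap {V : Type*} [Fintype V] (G : SimpleGraph V) : ℤ :=
  (G.chromaticNumber.toNat : ℤ) - (G.cliqueNum : ℤ)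

/-! Induct on vertex sets. An independent triple can be deleted: three vertices go, `χ` drops by at
most one, and the gap by at most one. A vertex whose deletion keeps `χ` can be deleted as well. If
the complement is disconnected the graph is a join, across which `χ` is subadditive and `ω`
superadditive, so the two sides share the gap.

What remains is vertex-critical with connected complement and independence number at most two.
Colourings are then matchings of the complement, and Gallai's lemma (`deficiency_le_one`) gives `2χ
≤ n + 1`. With `n < χ + 2k` this forces `ω ≤ k ≤ 4` and `n ≥ 4ω - 1`, against the Ramsey bound `2n ≤
ω(ω + 3)`. The contradiction first fails at `ω = 5`, hence the limit 4. -/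

namespace SimpleGraph

open Finset
open scoped Classical

/-! ### Chromatic and clique numbers of vertex subsets -/

section ChiOn

variable {V : Type*} (G : SimpleGraph V)

/-- The subgraph induced on `s` has a proper colouring with `m` colours. -/
def ColorableOn (s : Finset V) (m : ℕ) : Prop :=
  ∃ f : V → ℕ, (∀ v ∈ s, f v < m) ∧ ∀ u ∈ s, ∀ v ∈ s, G.Adj u v → f u ≠ f v

lemma exists_colorableOn (s : Finset V) : G.ColorableOn s s.card := by
  refine ⟨fun v => if h : v ∈ s then (s.equivFin ⟨v, h⟩ : ℕ) else 0, ?_, ?_⟩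
  · intro v hv
    simp [hv]
  · intro u hu v hv huv h
    simp only [hu, hv, dif_pos] at h
    have := s.equivFin.injective (Fin.ext h)
    simp only [Subtype.mk.injEq] at this
    exact huv.ne this

lemma exists_colorableOn' (s : Finset V) : ∃ m, G.ColorableOn s m :=
  ⟨_, G.exists_colorableOn s⟩

/-- The chromatic number of the subgraph induced on `s`. -/
noncomputable def chiOn (s : Finset V) : ℕ := Nat.find (G.exists_colorableOn' s)

lemma colorableOn_chiOn (s : Finset V) : G.ColorableOn s (G.chiOn s) :=
  Nat.find_spec (G.exists_colorableOn' s)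

variable {G}

lemma ColorableOn.chiOn_le {s : Finset V} {m : ℕ} (h : G.ColorableOn s m) : G.chiOn s ≤ m :=
  Nat.find_min' (G.exists_colorableOn' s) h

variable (G)

lemma chiOn_le_card (s : Finset V) : G.chiOn s ≤ s.card := (G.exists_colorableOn s).chiOn_le

lemma chiOn_union_le (s t : Finset V) : G.chiOn (s ∪ t) ≤ G.chiOn s + G.chiOn t := by
  obtain ⟨f, hf, hf'⟩ := G.colorableOn_chiOn s
  obtain ⟨g, hg, hg'⟩ := G.colorableOn_chiOn t
  refine ColorableOn.chiOn_le ⟨fun v => if v ∈ s then f v else G.chiOn s + g v, ?_, ?_⟩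
  · intro v hv
    by_cases h : v ∈ s
    · have := hf v h
      simp only [h, if_true]; omega
    · have := hg v ((mem_union.1 hv).resolve_left h)
      simp only [h, if_false]; omega
  · intro u hu v hv huv
    by_cases h : u ∈ s <;> by_cases h' : v ∈ s <;> simp only [h, h', if_true, if_false]
    · exact hf' u h v h' huv
    · have := hf u h
      omega
    · have := hf v h'
      omega
    · have := hg' u ((mem_union.1 hu).resolve_left h) v ((mem_union.1 hv).resolve_left h') huv
      omega

lemma chiOn_le_one {t : Finset V} (ht : ∀ u ∈ t, ∀ v ∈ t, ¬ G.Adj u v) : G.chiOn t ≤ 1 :=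
  ColorableOn.chiOn_le ⟨fun _ => 0, by simp, fun u hu v hv h => (ht u hu v hv h).elim⟩

lemma chiOn_le_sdiff_add_one {s t : Finset V} (hts : t ⊆ s)
    (ht : ∀ u ∈ t, ∀ v ∈ t, ¬ G.Adj u v) : G.chiOn s ≤ G.chiOn (s \ t) + 1 := by
  have h := G.chiOn_union_le (s \ t) t
  rw [sdiff_union_of_subset hts] at h
  have := G.chiOn_le_one ht
  omega

/-- An optimal colouring has a colour class through any given vertex; deleting it lowers the
chromatic number. -/
lemma exists_indep_chiOn_sdiff {s : Finset V} {x : V} (hx : x ∈ s) :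
    ∃ t ⊆ s, x ∈ t ∧ (∀ u ∈ t, ∀ v ∈ t, ¬ G.Adj u v) ∧ G.chiOn (s \ t) + 1 ≤ G.chiOn s := by
  obtain ⟨f, hf, hf'⟩ := G.colorableOn_chiOn s
  refine ⟨s.filter (fun v => f v = f x), filter_subset _ _, by simp [hx], ?_, ?_⟩
  · intro u hu v hv h
    rw [mem_filter] at hu hv
    exact hf' u hu.1 v hv.1 h (hu.2.trans hv.2.symm)
  · have hpos := hf x hx
    have : G.ColorableOn (s \ s.filter (fun v => f v = f x)) (G.chiOn s - 1) := by
      -- The colour of `x` is no longer used, so the colours above it shift down by one.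
      refine ⟨fun v => if f v < f x then f v else f v - 1, ?_, ?_⟩
      · intro v hv
        simp only [mem_sdiff, mem_filter, not_and] at hv
        have h1 := hf v hv.1
        have h2 := hv.2 hv.1
        dsimp only
        split_ifs <;> omega
      · intro u hu v hv huv
        simp only [mem_sdiff, mem_filter, not_and] at hu hv
        have h1 := hf' u hu.1 v hv.1 huv
        have h2 := hv.2 hv.1
        have h3 := hu.2 hu.1
        dsimp only
        split_ifs <;> omega
    have := this.chiOn_le
    omega

/-- The clique number of the subgraph induced on `s`. -/
noncomputable def omegaOn (s : Finset V) : ℕ :=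
  (s.powerset.filter (fun t : Finset V => G.IsClique (t : Set V))).sup card

variable {G}

lemma IsClique.card_le_omegaOn {s t : Finset V} (hts : t ⊆ s) (ht : G.IsClique (t : Set V)) :
    t.card ≤ G.omegaOn s :=
  le_sup (f := card) (by simp [hts, ht])

variable (G)

lemma exists_isClique_card_eq_omegaOn (s : Finset V) :
    ∃ t ⊆ s, G.IsClique (t : Set V) ∧ t.card = G.omegaOn s := by
  obtain ⟨t, ht, h⟩ := exists_mem_eq_sup (s.powerset.filter (fun t : Finset V => G.IsClique (t : Set V)))
    ⟨∅, by simp⟩ card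
  simp only [mem_filter, mem_powerset] at ht
  exact ⟨t, ht.1, ht.2, h.symm⟩

lemma omegaOn_mono {s t : Finset V} (h : s ⊆ t) : G.omegaOn s ≤ G.omegaOn t := by
  obtain ⟨u, hu, hc, hcard⟩ := G.exists_isClique_card_eq_omegaOn s
  exact hcard ▸ hc.card_le_omegaOn (hu.trans h)

lemma omegaOn_le_chiOn (s : Finset V) : G.omegaOn s ≤ G.chiOn s := by
  obtain ⟨u, hu, hc, hcard⟩ := G.exists_isClique_card_eq_omegaOn s
  obtain ⟨f, hf, hf'⟩ := G.colorableOn_chiOn s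
  rw [← hcard, ← card_range (G.chiOn s)]
  refine card_le_card_of_injOn f (fun v hv => by simpa using hf v (hu hv)) ?_
  intro a ha b hb hab
  by_contra hne
  exact hf' a (hu ha) b (hu hb) (hc ha hb hne) hab

lemma omegaOn_add_le {s t : Finset V} (h : ∀ u ∈ s, ∀ v ∈ t, G.Adj u v) :
    G.omegaOn s + G.omegaOn t ≤ G.omegaOn (s ∪ t) := by
  obtain ⟨a, ha, hac, hacard⟩ := G.exists_isClique_card_eq_omegaOn s
  obtain ⟨b, hb, hbc, hbcard⟩ := G.exists_isClique_card_eq_omegaOn t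
  have hd : Disjoint a b := Finset.disjoint_left.2 fun v hva hvb => (h v (ha hva) v (hb hvb)).ne rfl
  rw [← hacard, ← hbcard, ← card_union_of_disjoint hd]
  refine IsClique.card_le_omegaOn (union_subset_union ha hb) ?_
  intro u hu v hv hne
  simp only [coe_union, Set.mem_union, mem_coe] at hu hv
  rcases hu with hu | hu <;> rcases hv with hv | hv
  · exact hac hu hv hne
  · exact h u (ha hu) v (hb hv)
  · exact (h v (ha hv) u (hb hu)).symm
  · exact hbc hu hv hne

/-- The Ramsey bound for graphs with independence number at most two: the neighbours of a vertex have
smaller clique number, and its non-neighbours form a clique. -/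
lemma two_mul_card_le_of_indep_card_le_two (w : ℕ) : ∀ s : Finset V,
    (∀ t ⊆ s, (∀ u ∈ t, ∀ v ∈ t, ¬ G.Adj u v) → t.card ≤ 2) → G.omegaOn s ≤ w →
      2 * s.card ≤ w * (w + 3) := by
  induction w with
  | zero =>
    intro s _ hw
    rcases s.eq_empty_or_nonempty with rfl | ⟨x, hx⟩
    · simp
    · have := IsClique.card_le_omegaOn (G := G) (s := s) (t := {x}) (by simpa) (by simp)
      simp at this; omega
  | succ w ih =>
    intro s hs hw
    rcases s.eq_empty_or_nonempty with rfl | ⟨x, hx⟩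
    · simp
    have hA := ih (s.filter (fun v => G.Adj x v))
      (fun t ht => hs t (ht.trans (filter_subset _ _))) (by
        have := G.omegaOn_add_le (s := {x}) (t := s.filter (fun v => G.Adj x v)) (by simp)
        have h1 := G.omegaOn_mono (s := {x} ∪ s.filter (fun v => G.Adj x v)) (t := s)
          (union_subset (by simpa) (filter_subset _ _))
        have h2 := IsClique.card_le_omegaOn (G := G) (s := {x}) (t := {x}) (by simp) (by simp)
        simp only [card_singleton] at h2
        omega)
    have hB : (s.filter (fun v => ¬ G.Adj x v ∧ v ≠ x)).card ≤ w + 1 := by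
      refine le_trans (IsClique.card_le_omegaOn (filter_subset _ _) ?_) hw
      intro u hu v hv hne
      by_contra h
      simp only [coe_filter, Set.mem_ofPred_eq] at hu hv
      have := hs {x, u, v} (by
        intro y hy
        simp only [mem_insert, mem_singleton] at hy
        rcases hy with rfl | rfl | rfl
        exacts [hx, hu.1, hv.1]) (by
        intro a ha b hb
        simp only [mem_insert, mem_singleton] at ha hb
        have h1 := hu.2.1
        have h2 := hv.2.1
        rcases ha with rfl | rfl | rfl <;> rcases hb with rfl | rfl | rfl <;>
          first | assumption | exact G.irrefl | (rw [adj_comm]; assumption))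
      rw [card_eq_three.2 ⟨x, u, v, hu.2.2.symm, hv.2.2.symm, hne, rfl⟩] at this
      omega
    have hC : s ⊆ insert x (s.filter (fun v => G.Adj x v) ∪
        s.filter (fun v => ¬ G.Adj x v ∧ v ≠ x)) := by
      intro v hv
      simp only [mem_insert, mem_union, mem_filter]
      tauto
    have h1 := (card_le_card hC).trans (card_insert_le _ _)
    have h2 := card_union_le (s.filter (fun v => G.Adj x v))
      (s.filter (fun v => ¬ G.Adj x v ∧ v ≠ x))
    nlinarith

end ChiOn

/-! ### Matchings of the complement and Gallai's lemma -/

section Pairing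

variable {V : Type*} (G : SimpleGraph V)

/-- An involution moving only vertices of `s`, each to a nonadjacent one: a matching in the
complement of the subgraph induced on `s`. -/
structure IsPairing (s : Finset V) (σ : V → V) : Prop where
  invol : Function.Involutive σ
  fix : ∀ v, v ∉ s → σ v = v
  nadj : ∀ v, ¬ G.Adj v (σ v)

/-- The number of vertices of `s` left unmatched. -/
noncomputable def deficiency (s : Finset V) (σ : V → V) : ℕ :=
  (s.filter (fun v => σ v = v)).card

variable {G}

lemma IsPairing.mem {s : Finset V} {σ : V → V} (h : G.IsPairing s σ) {v : V} (hv : v ∈ s) :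
    σ v ∈ s := by
  by_contra hn
  have h1 := h.fix _ hn
  rw [h.invol v] at h1
  exact hn (h1 ▸ hv)

lemma isPairing_id (s : Finset V) : G.IsPairing s id :=
  ⟨fun _ => rfl, fun _ _ => rfl, fun _ => G.irrefl⟩

lemma IsPairing.mono {s t : Finset V} {σ : V → V} (h : G.IsPairing s σ) (hst : s ⊆ t) :
    G.IsPairing t σ :=
  ⟨h.invol, fun v hv => h.fix v fun h' => hv (hst h'), h.nadj⟩

lemma IsPairing.deficiency_eq {s t : Finset V} {σ : V → V} (h : G.IsPairing s σ)
    (hst : s ⊆ t) : deficiency t σ + s.card = deficiency s σ + t.card := by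
  have h1 : t.filter (fun v => σ v = v) = s.filter (fun v => σ v = v) ∪ t \ s := by
    ext v
    simp only [mem_filter, mem_union, mem_sdiff]
    by_cases hv : v ∈ s
    · simp [hv, hst hv]
    · simp [hv, h.fix v hv]
  have h2 : Disjoint (s.filter (fun v => σ v = v)) (t \ s) :=
    disjoint_sdiff.mono_left (filter_subset _ _)
  rw [deficiency, deficiency, h1, card_union_of_disjoint h2]
  have := card_sdiff_add_card_eq_card hst
  omega

/-- Matching two unmatched nonadjacent vertices. -/
lemma IsPairing.exists_deficiency_add_two {s : Finset V} {σ : V → V} (h : G.IsPairing s σ)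
    {x y : V} (hx : x ∈ s) (hy : y ∈ s) (hne : x ≠ y) (hxy : ¬ G.Adj x y) (hσx : σ x = x)
    (hσy : σ y = y) : ∃ τ, G.IsPairing s τ ∧ deficiency s τ + 2 = deficiency s σ := by
  have hout : ∀ v, v ≠ x → v ≠ y → σ v ≠ x ∧ σ v ≠ y := fun v h1 h2 =>
    ⟨fun e => h1 (h.invol.injective (e.trans hσx.symm)),
      fun e => h2 (h.invol.injective (e.trans hσy.symm))⟩
  let τ : V → V := fun v => if v = x then y else if v = y then x else σ v
  have hτx : τ x = y := by simp [τ]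
  have hτy : τ y = x := by simp [τ, hne.symm]
  have hτ : ∀ v, v ≠ x → v ≠ y → τ v = σ v := fun v h1 h2 => by simp [τ, h1, h2]
  refine ⟨τ, ⟨?_, ?_, ?_⟩, ?_⟩
  · intro v
    by_cases h1 : v = x
    · rw [h1, hτx, hτy]
    by_cases h2 : v = y
    · rw [h2, hτy, hτx]
    rw [hτ v h1 h2, hτ _ (hout v h1 h2).1 (hout v h1 h2).2, h.invol v]
  · intro v hv
    rw [hτ v (fun e => hv (e ▸ hx)) (fun e => hv (e ▸ hy)), h.fix v hv]
  · intro v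
    by_cases h1 : v = x
    · rwa [h1, hτx]
    by_cases h2 : v = y
    · rwa [h2, hτy, adj_comm]
    rw [hτ v h1 h2]
    exact h.nadj v
  · have h1 : s.filter (fun v => σ v = v) = s.filter (fun v => τ v = v) ∪ {x, y} := by
      ext v
      simp only [mem_filter, mem_union, mem_insert, mem_singleton]
      by_cases h1 : v = x
      · simp [h1, hx, hσx]
      by_cases h2 : v = y
      · simp [h2, hy, hσy]
      simp [h1, h2, hτ v h1 h2]
    have h2 : Disjoint (s.filter (fun v => τ v = v)) {x, y} := by
      rw [Finset.disjoint_left]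
      intro v hv hv'
      simp only [mem_filter, mem_insert, mem_singleton] at hv hv'
      rcases hv' with rfl | rfl
      · exact hne (hτx ▸ hv.2).symm
      · exact hne (hτy ▸ hv.2)
    rw [deficiency, deficiency, h1, card_union_of_disjoint h2, card_pair hne]

/-- A pairing is a colouring with classes of size at most two. -/
lemma two_mul_chiOn_le_of_involutive {σ : V → V} (hinv : Function.Involutive σ)
    (hadj : ∀ v, ¬ G.Adj v (σ v)) (s : Finset V) :
    (∀ v ∈ s, σ v ∈ s) → 2 * G.chiOn s ≤ s.card + deficiency s σ := by
  -- Only invariance of `s` is assumed: after a pair is removed, `σ` still moves it, so `IsPairing`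
  -- would not survive the induction.
  induction s using Finset.strongInduction with
  | H s ih =>
    intro hs
    by_cases hfix : ∀ v ∈ s, σ v = v
    · have := G.chiOn_le_card s
      rw [deficiency, filter_true_of_mem hfix]
      omega
    push Not at hfix
    obtain ⟨x, hx, hne⟩ := hfix
    have hsub : ({x, σ x} : Finset V) ⊆ s := by
      intro v hv
      simp only [mem_insert, mem_singleton] at hv
      rcases hv with rfl | rfl
      exacts [hx, hs _ hx]
    have h1 := ih (s \ {x, σ x}) (sdiff_ssubset hsub ⟨x, by simp⟩) (by
      intro v hv
      simp only [mem_sdiff, mem_insert, mem_singleton, not_or] at hv ⊢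
      refine ⟨hs v hv.1, fun e => hv.2.2 (by rw [← e, hinv v]),
        fun e => hv.2.1 (hinv.injective e)⟩)
    have h2 := G.chiOn_le_sdiff_add_one hsub (by
      intro a ha b hb
      have := hadj x
      simp only [mem_insert, mem_singleton] at ha hb
      rcases ha with rfl | rfl <;> rcases hb with rfl | rfl <;>
        first | assumption | exact G.irrefl | (rw [adj_comm]; assumption))
    have h3 := card_sdiff_add_card_eq_card hsub
    rw [card_pair hne.symm] at h3
    have h4 : deficiency (s \ {x, σ x}) σ ≤ deficiency s σ :=
      card_le_card (filter_subset_filter _ sdiff_subset)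
    omega

/-- A colouring with classes of size at most two yields a pairing. -/
lemma exists_isPairing_le (s : Finset V) :
    (∀ t ⊆ s, (∀ u ∈ t, ∀ v ∈ t, ¬ G.Adj u v) → t.card ≤ 2) →
      ∃ σ, G.IsPairing s σ ∧ s.card + deficiency s σ ≤ 2 * G.chiOn s := by
  induction s using Finset.strongInduction with
  | H s ih =>
    intro hs
    rcases s.eq_empty_or_nonempty with rfl | ⟨x, hx⟩
    · exact ⟨id, isPairing_id _, by simp [deficiency]⟩
    obtain ⟨t, hts, hxt, hind, hchi⟩ := G.exists_indep_chiOn_sdiff hx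
    obtain ⟨σ, hσ, hle⟩ := ih (s \ t) (sdiff_ssubset hts ⟨x, hxt⟩)
      (fun u hu => hs u (hu.trans sdiff_subset))
    have hσs := hσ.mono (sdiff_subset : s \ t ⊆ s)
    have h1 := hσ.deficiency_eq (sdiff_subset : s \ t ⊆ s)
    have h2 := card_sdiff_add_card_eq_card hts
    have h3 := hs t hts hind
    have h4 : 0 < t.card := card_pos.2 ⟨x, hxt⟩
    rcases (by omega : t.card = 1 ∨ t.card = 2) with h5 | h5
    · exact ⟨σ, hσs, by omega⟩
    · obtain ⟨a, b, hab, rfl⟩ := card_eq_two.1 h5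
      obtain ⟨τ, hτ, hd⟩ := hσs.exists_deficiency_add_two (x := a) (y := b)
        (hts (by simp)) (hts (by simp)) hab (hind a (by simp) b (by simp))
        (hσ.fix a (by simp)) (hσ.fix b (by simp))
      exact ⟨τ, hτ, by omega⟩

lemma IsPairing.piecewise {s : Finset V} {σ τ : V → V} (hσ : G.IsPairing s σ)
    (hτ : G.IsPairing s τ) {C : Set V} (hCσ : ∀ v, v ∈ C → σ v ∈ C) (hCτ : ∀ v, v ∈ C → τ v ∈ C) :
    G.IsPairing s (fun v => if v ∈ C then τ v else σ v) := by
  refine ⟨?_, ?_, ?_⟩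
  · intro v
    by_cases hv : v ∈ C
    · simp [hv, hCτ v hv, hτ.invol v]
    · have : σ v ∉ C := fun h => hv (by simpa [hσ.invol v] using hCσ _ h)
      simp [hv, this, hσ.invol v]
  · intro v hv
    simp [hσ.fix v hv, hτ.fix v hv]
  · intro v
    split_ifs
    exacts [hτ.nadj v, hσ.nadj v]

/-- Swapping on `C` only redistributes the unmatched vertices: if one hybrid is no better than `τ`,
the other is no worse than `σ`. -/
lemma deficiency_piecewise_add (s : Finset V) (σ τ : V → V) (C : Set V) :
    deficiency s (fun v => if v ∈ C then τ v else σ v) +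
      deficiency s (fun v => if v ∈ C then σ v else τ v) = deficiency s σ + deficiency s τ := by
  simp only [deficiency, card_filter]
  rw [← sum_add_distrib, ← sum_add_distrib]
  refine sum_congr rfl fun v _ => ?_
  by_cases hv : v ∈ C <;> simp [hv, add_comm]

/-- The orbit of a fixed point of `τ` under the group generated by two involutions `σ` and `τ`
contains at most one fixed point of `σ`. -/
lemma exists_closed_of_involutive {σ τ : V → V} (hσ : Function.Involutive σ)
    (hτ : Function.Involutive τ) {y : V} (hy : τ y = y) :
    ∃ C : Set V, y ∈ C ∧ (∀ v, v ∈ C → σ v ∈ C) ∧ (∀ v, v ∈ C → τ v ∈ C) ∧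
      ∀ x ∈ C, ∀ z ∈ C, σ x = x → σ z = z → x = z := by
  -- In the finite picture the orbit is an alternating path with end `y`, and only its other end can
  -- be fixed by `σ`. Algebraically, `τ` fixes `y`, so the orbit consists of the points `g ^ k y`,
  -- on which both involutions act by reflecting `k`.
  let S : Equiv.Perm V := hσ.toPerm
  let T : Equiv.Perm V := hτ.toPerm
  have hS : S * S = 1 := Equiv.ext hσ
  have hT : T * T = 1 := Equiv.ext hτ
  have hTi : T⁻¹ = T := inv_eq_of_mul_eq_one_left hT
  have hSi : S⁻¹ = S := inv_eq_of_mul_eq_one_left hS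
  let g : Equiv.Perm V := T * S
  have hconj : ∀ k : ℤ, T * g ^ k * T = g ^ (-k) := by
    intro k
    have h1 : T * g * T⁻¹ = g⁻¹ := by
      simp only [g, mul_inv_rev, hTi, hSi]
      rw [← mul_assoc, hT, one_mul]
    have h2 := conj_zpow (a := T) (b := g) (i := k)
    rw [h1, inv_zpow', hTi] at h2
    exact h2.symm
  have hTk : ∀ k : ℤ, τ ((g ^ k) y) = (g ^ (-k)) y := by
    intro k
    rw [← hconj k]
    change _ = τ ((g ^ k) (τ y))
    rw [hy]
  have hSk : ∀ k : ℤ, σ ((g ^ k) y) = (g ^ (-k - 1)) y := by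
    intro k
    have : σ ((g ^ k) y) = τ ((g ^ (1 + k)) y) := by
      rw [zpow_add, zpow_one]
      change _ = τ (τ (σ ((g ^ k) y)))
      rw [hτ]
    rw [this, hTk]
    congr 2
    ring
  refine ⟨{v | ∃ k : ℤ, (g ^ k) y = v}, ⟨0, rfl⟩, ?_, ?_, ?_⟩
  · rintro _ ⟨k, rfl⟩
    exact ⟨_, (hSk k).symm⟩
  · rintro _ ⟨k, rfl⟩
    exact ⟨_, (hTk k).symm⟩
  · rintro _ ⟨a, rfl⟩ _ ⟨b, rfl⟩ ha hb
    let H := (MulAction.stabilizer (Equiv.Perm V) y)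
    have key : ∀ c d : ℤ, (g ^ c) y = (g ^ d) y ↔ g ^ (d - c) ∈ H := by
      intro c d
      rw [MulAction.mem_stabilizer_iff, sub_eq_neg_add, zpow_add, zpow_neg, mul_smul,
        inv_smul_eq_iff]
      exact eq_comm
    rw [hSk, key] at ha hb
    rw [key]
    -- The exponents `2a + 1` and `2b + 1` stabilize `y`, hence so does `(2a + 1)(b - a) + 2(a - b)a
    -- = b - a`.
    have h1 := H.mul_mem (H.zpow_mem ha (b - a)) (H.zpow_mem (H.mul_mem ha (H.inv_mem hb)) a)
    convert h1 using 1
    rw [← zpow_neg, ← zpow_add, ← zpow_mul, ← zpow_mul, ← zpow_add]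
    congr 1
    ring

/-- The exchange step of Gallai's lemma. -/
lemma IsPairing.exists_exchange {s : Finset V} {σ τ : V → V} (hσ : G.IsPairing s σ)
    (hτ : G.IsPairing s τ) {x y z : V} (hx : σ x = x) (hz : σ z = z) (hxz : x ≠ z) (hy : τ y = y)
    (hmin : ∀ ρ, G.IsPairing s ρ → deficiency s τ ≤ deficiency s ρ) :
    ∃ ρ, G.IsPairing s ρ ∧ deficiency s ρ ≤ deficiency s σ ∧ ρ y = y ∧ (ρ x = x ∨ ρ z = z) := by
  obtain ⟨C, hyC, hCσ, hCτ, hC⟩ := exists_closed_of_involutive hσ.invol hτ.invol hy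
  refine ⟨_, hσ.piecewise hτ hCσ hCτ, ?_, by simp [hyC, hy], ?_⟩
  · have h1 := deficiency_piecewise_add s σ τ C
    have h2 := hmin _ (hτ.piecewise hσ hCτ hCσ)
    omega
  · by_cases hxC : x ∈ C
    · right
      have : z ∉ C := fun hzC => hxz (hC x hxC z hzC hx hz)
      simp [this, hz]
    · left
      simp [hxC, hx]

/-- Gallai's lemma: if the complement of the graph induced on `s` is connected and every vertex is
missed by an optimal pairing, then an optimal pairing misses at most one vertex. -/
lemma deficiency_le_one {s : Finset V} {D : ℕ}
    (hmin : ∀ ρ, G.IsPairing s ρ → D ≤ deficiency s ρ)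
    (hmiss : ∀ y ∈ s, ∃ ρ, G.IsPairing s ρ ∧ deficiency s ρ ≤ D ∧ ρ y = y)
    (hconn : ∀ A ⊆ s, A.Nonempty → (s \ A).Nonempty → ∃ u ∈ A, ∃ v ∈ s \ A, ¬ G.Adj u v)
    {σ : V → V} (hσ : G.IsPairing s σ) (hσD : deficiency s σ ≤ D) : deficiency s σ ≤ 1 := by
  rw [deficiency, card_le_one]
  intro x hx z hz
  rw [mem_filter] at hx hz
  by_contra hxz
  -- No optimal pairing misses both `a` and `b`. This contains nonadjacency and is transitive, so
  -- connectedness spreads it over `s`.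
  let R : V → V → Prop := fun a b =>
    a ≠ b → ∀ ρ, G.IsPairing s ρ → deficiency s ρ ≤ D → ρ a = a → ρ b = b → False
  have hadj : ∀ a ∈ s, ∀ b ∈ s, ¬ G.Adj a b → R a b := by
    intro a ha b hb hab hne ρ hρ hρD h1 h2
    obtain ⟨τ, hτ, hd⟩ := hρ.exists_deficiency_add_two ha hb hne hab h1 h2
    have := hmin τ hτ
    omega
  have htrans : ∀ a b c, b ∈ s → R a b → R b c → R a c := by
    intro a b c hb hab hbc hac ρ hρ hρD h1 h2
    by_cases e1 : a = b
    · exact hbc (e1 ▸ hac) ρ hρ hρD (e1 ▸ h1) h2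
    by_cases e2 : b = c
    · exact hab e1 ρ hρ hρD h1 (e2 ▸ h2)
    -- Exchanging with an optimal pairing that misses `b` gives one missing `b` together with `a` or
    -- `c`.
    obtain ⟨τ, hτ, hτD, hτb⟩ := hmiss b hb
    obtain ⟨π, hπ, hπd, hπb, h3 | h3⟩ :=
      hρ.exists_exchange hτ h1 h2 hac hτb (fun π hπ => hτD.trans (hmin π hπ))
    · exact hab e1 π hπ (hπd.trans hρD) h3 hπb
    · exact hbc e2 π hπ (hπd.trans hρD) hπb h3
  have hall : s \ s.filter (fun b => R x b) = ∅ := by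
    by_contra hne
    obtain ⟨u, hu, v, hv, huv⟩ := hconn _ (filter_subset _ _)
      ⟨x, mem_filter.2 ⟨hx.1, fun h => (h rfl).elim⟩⟩ (nonempty_iff_ne_empty.2 hne)
    rw [mem_filter] at hu
    simp only [mem_sdiff, mem_filter, not_and] at hv
    exact hv.2 hv.1 (htrans x u v hu.1 hu.2 (hadj u hu.1 v hv.1 huv))
  have hz' : z ∈ s.filter (fun b => R x b) := by
    by_contra h
    exact (eq_empty_iff_forall_notMem.1 hall z) (mem_sdiff.2 ⟨hz.1, h⟩)
  exact (mem_filter.1 hz').2 hxz σ hσ hσD hx.2 hz.2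

/-- Gallai's bound for vertex-critical graphs with connected complement, in the case of
independence number at most two. -/
lemma two_mul_chiOn_le_card_add_one {s : Finset V}
    (hs : ∀ t ⊆ s, (∀ u ∈ t, ∀ v ∈ t, ¬ G.Adj u v) → t.card ≤ 2)
    (hcrit : ∀ v ∈ s, G.chiOn (s.erase v) + 1 ≤ G.chiOn s)
    (hconn : ∀ A ⊆ s, A.Nonempty → (s \ A).Nonempty → ∃ u ∈ A, ∃ v ∈ s \ A, ¬ G.Adj u v) :
    2 * G.chiOn s ≤ s.card + 1 := by
  have hlow : ∀ ρ, G.IsPairing s ρ → 2 * G.chiOn s ≤ s.card + deficiency s ρ := fun ρ hρ =>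
    two_mul_chiOn_le_of_involutive hρ.invol hρ.nadj s fun v hv => hρ.mem hv
  obtain ⟨σ, hσ, hle⟩ := exists_isPairing_le s hs
  have h1 := hlow σ hσ
  -- By `hle` the subtraction is not truncated; `D` is the least deficiency.
  have := deficiency_le_one (D := 2 * G.chiOn s - s.card) (fun ρ hρ => by have := hlow ρ hρ; omega)
    (fun y hy => by
      -- By criticality, an optimal pairing of `s.erase y` stays optimal on `s` with `y` left
      -- single.
      obtain ⟨ρ, hρ, hρle⟩ := exists_isPairing_le (G := G) (s.erase y)
        (fun t ht => hs t (ht.trans (erase_subset _ _)))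
      have h2 := hρ.deficiency_eq (erase_subset y s)
      have h3 := hcrit y hy
      have h4 := card_erase_add_one hy
      exact ⟨ρ, hρ.mono (erase_subset _ _), by omega, hρ.fix y (by simp)⟩)
    hconn hσ (by omega)
  omega

end Pairing

/-! ### The induction and the passage to the whole graph -/

section Bound

variable {V : Type*} (G : SimpleGraph V)

/-- Here `k` is only a lower bound for the gap: deletions may lower `ω` and push the gap itself
above 4. -/
theorem chiOn_add_two_mul_le_card (s : Finset V) :
    ∀ k ≤ 4, G.omegaOn s + k ≤ G.chiOn s → G.chiOn s + 2 * k ≤ s.card := by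
  induction s using Finset.strongInduction with
  | H s ih =>
    intro k hk hgap
    rcases Nat.eq_zero_or_pos k with rfl | hkpos
    · simpa using G.chiOn_le_card s
    by_cases hs : ∀ t ⊆ s, (∀ u ∈ t, ∀ v ∈ t, ¬ G.Adj u v) → t.card ≤ 2
    swap
    · push Not at hs
      obtain ⟨t, hts, hind, hcard⟩ := hs
      have hne : t.Nonempty := card_pos.1 (by omega)
      have h1 := G.chiOn_le_sdiff_add_one hts hind
      have h2 := G.omegaOn_mono (sdiff_subset : s \ t ⊆ s)
      have h3 := ih (s \ t) (sdiff_ssubset hts hne) (k - 1) (by omega) (by omega)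
      have h4 := card_sdiff_add_card_eq_card hts
      omega
    by_cases hcrit : ∀ v ∈ s, G.chiOn (s.erase v) + 1 ≤ G.chiOn s
    swap
    · push Not at hcrit
      obtain ⟨v, hv, hlt⟩ := hcrit
      have h2 := G.omegaOn_mono (erase_subset v s)
      have h3 := ih (s.erase v) (erase_ssubset hv) k hk (by omega)
      have h4 := card_erase_add_one hv
      omega
    by_cases hconn : ∀ A ⊆ s, A.Nonempty → (s \ A).Nonempty → ∃ u ∈ A, ∃ v ∈ s \ A, ¬ G.Adj u v
    swap
    · push Not at hconn
      obtain ⟨A, hA, hAne, hBne, hjoin⟩ := hconn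
      have h1 := G.chiOn_union_le A (s \ A)
      have h2 := G.omegaOn_add_le hjoin
      rw [union_sdiff_of_subset hA] at h1 h2
      have hAs : A ⊂ s := hA.ssubset_of_ne fun h => by simp [h] at hBne
      have hA' := G.omegaOn_le_chiOn A
      have hB' := G.omegaOn_le_chiOn (s \ A)
      -- `A` takes as much of `k` as its gap allows; the gap of `s \ A` covers the rest.
      have h3 := ih A hAs (min k (G.chiOn A - G.omegaOn A)) (by omega) (by omega)
      have h4 := ih (s \ A) (sdiff_ssubset hA hAne) (k - min k (G.chiOn A - G.omegaOn A))
        (by omega) (by omega)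
      have h5 := card_sdiff_add_card_eq_card hA
      omega
    have h1 := two_mul_chiOn_le_card_add_one hs hcrit hconn
    have h2 := G.two_mul_card_le_of_indep_card_le_two _ s hs le_rfl
    by_contra hlt
    have hw : G.omegaOn s ≤ 4 := by omega
    have hw0 : G.omegaOn s ≠ 0 := by
      intro h0
      rw [h0] at h2
      omega
    generalize G.omegaOn s = w at *
    interval_cases w <;> omega

lemma omegaOn_univ [Fintype V] : G.omegaOn univ = G.cliqueNum := by
  apply le_antisymm
  · obtain ⟨t, -, hc, hcard⟩ := G.exists_isClique_card_eq_omegaOn univ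
    rw [← hcard]
    exact IsClique.card_le_cliqueNum (tc := hc)
  · obtain ⟨t, ht⟩ := G.exists_isNClique_cliqueNum
    rw [← ht.card_eq]
    exact ht.isClique.card_le_omegaOn (subset_univ _)

lemma chiOn_univ [Fintype V] : G.chiOn univ = G.chromaticNumber.toNat := by
  have hfin : G.chromaticNumber ≠ ⊤ :=
    chromaticNumber_ne_top_iff_exists.2 ⟨_, G.colorable_of_fintype⟩
  apply le_antisymm
  · obtain ⟨C⟩ := G.colorable_chromaticNumber_of_fintype
    exact ColorableOn.chiOn_le ⟨fun v => C v, fun v _ => (C v).2,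
      fun u _ v _ h e => C.valid h (Fin.ext e)⟩
  · obtain ⟨f, hf, hf'⟩ := G.colorableOn_chiOn univ
    have hcol : G.Colorable (G.chiOn univ) :=
      ⟨Coloring.mk (fun v => ⟨f v, hf v (mem_univ v)⟩) fun {u v} h e =>
        hf' u (mem_univ u) v (mem_univ v) h (Fin.ext_iff.1 e)⟩
    exact ENat.toNat_le_of_le_natCast hcol.chromaticNumber_le

end Bound

end SimpleGraph

theorem corollary5p1 {V : Type*} [Fintype V] (G : SimpleGraph V) (hG : chromaticGap G ≤ 4) :
    (Fintype.card V : ℤ) ≥ (G.chromaticNumber.toNat : ℤ) + 2 * chromaticGap G := by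
  unfold chromaticGap at *
  have h1 := G.omegaOn_le_chiOn Finset.univ
  -- By `h1` this natural subtraction agrees with the integer gap.
  have h2 := G.chiOn_add_two_mul_le_card Finset.univ
    (G.chiOn Finset.univ - G.omegaOn Finset.univ)
  rw [G.omegaOn_univ, G.chiOn_univ] at h1 h2
  rw [Finset.card_univ] at h2
  omega
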